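/- Let $m\ge 2$ and $n\ge 1$ be integers, and let $F_m$ be the free group on $a_1,\dots,a_m$, with identity $e$ and word length $|\cdot|$ with respect to $a_1^{\pm1},\dots,a_m^{\pm1}$. Let $\mu$ be a probability measure on $F_m$ that is symmetric, i.e. $\mu(g^{-1})=\mu(g)$ for all $g\in F_m$, and whose support is exactly $\{a_i^j : 1\le i\le m,\ j\in\mathbb Z,\ 1\le |j|\le n\}$. Let $(X_k)_{k\ge 0}$ be the random walk $X_k=X_0g_1g_2\cdots g_k$ with independent increments $g_1,g_2,\dots$ of law $\mu$. Define the first-passage function and its exponential decay rate by $$F_\mu(x,y)=\sum_{k=0}^\infty \mathbb P\bigl(X_k=y,\ X_j\ne y\text{ for } j<k \,\bigm|\, X_0=x\bigr),\qquad \rho_\mu(g)=\liminf_{k\to\infty}F_\mu(e,g^k)^{1/k}.$$ Let $\partial F_m$ be the set of geodesic rays $r=(r_0,r_1,\dots)$ starting from $r_0=e$ in the Cayley graph of $F_m$ with respect to $a_1^{\pm1},\dots,a_m^{\pm1}$; a sequence $(x_k)$ in $F_m$ converges to $r$ if for every $l$ one has $|x_k|=|r_l|+|r_l^{-1}x_k|$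 for all sufficiently large $k$. For $g\in F_m$ let $C(g)\subset\partial F_m$ be the set of rays that contain $g$. Then almost every sample path of the random walk started at $e$ converges to a point of $\partial F_m$, and, if $\nu$ denotes the hitting measure (the law of the limit point), then for every $1\le i\le m$ $$\rho_\mu(a_i)\ \ge\ \frac{\nu(C(a_i))}{1-\nu(C(a_i))}.$$ -/

import Mathlib

open MeasureTheory Filter
open scoped ENNReal

namespace FreeGroupWalk

/-- The free group is a discrete space: every subset is measurable. -/
instance instMeasurableSpaceFreeGroup {α : Type*} : MeasurableSpace (FreeGroup α) := ⊤

instance instDiscreteMeasurableSpaceFreeGroup {α : Type*} :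
    DiscreteMeasurableSpace (FreeGroup α) := ⟨fun _ => trivial⟩

instance instCountableFreeGroup {α : Type*} [Countable α] : Countable (FreeGroup α) :=
  inferInstanceAs (Countable (Quot _))

/-! ### The random walk -/

/-- The law of a sequence of independent increments, each with distribution `μ`. -/
noncomputable def stepLaw {α : Type*} (μ : PMF (FreeGroup α)) : Measure (ℕ → FreeGroup α) :=
  Measure.infinitePi (fun _ : ℕ => μ.toMeasure)

/-- The position at time `k` of the (right) random walk started at `x` with increments `ω`,
that is `x * ω 0 * ω 1 * ⋯ * ω (k - 1)`. -/
def walk {α : Type*} (x : FreeGroup α) (ω : ℕ → FreeGroup α) : ℕ → FreeGroup α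
  | 0 => x
  | k + 1 => walk x ω k * ω k

/-- The first-passage function
`F_μ(x, y) = ∑ₖ ℙ(X₀ = x, Xₖ = y, Xⱼ ≠ y for j < k)`. -/
noncomputable def firstPassage {α : Type*} (μ : PMF (FreeGroup α)) (x y : FreeGroup α) : ℝ≥0∞ :=
  ∑' k : ℕ, stepLaw μ {ω | walk x ω k = y ∧ ∀ j < k, walk x ω j ≠ y}

/-- The exponential decay rate `ρ_μ(g) = liminf F_μ(e, g ^ k) ^ (1 / k)` as `k → ∞`. -/
noncomputable def decayRate {α : Type*} (μ : PMF (FreeGroup α)) (g : FreeGroup α) : ℝ≥0∞ :=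
  liminf (fun k : ℕ => firstPassage μ 1 (g ^ k) ^ (1 / (k : ℝ))) atTop

/-! ### The boundary -/

/-- The boundary `∂F` of the free group on `α`: geodesic rays `r 0, r 1, r 2, …` in the Cayley
graph for the free generators, starting at the identity. (`FreeGroup.norm` is the word length, so
the word distance from `x` to `y` is the length of `x⁻¹ * y`.) In a tree every boundary point is
represented by exactly one such ray. -/
def Boundary (α : Type*) [DecidableEq α] : Type _ :=
  {r : ℕ → FreeGroup α // r 0 = 1 ∧ ∀ i j, i ≤ j → ((r i)⁻¹ * r j).norm = j - i}

/-- The σ-algebra on the boundary generated by the coordinates `r ↦ r k`, equivalently by the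
cylinder sets; for countable `α` it is the Borel σ-algebra. -/
instance instMeasurableSpaceBoundary (α : Type*) [DecidableEq α] :
    MeasurableSpace (Boundary α) :=
  inferInstanceAs (MeasurableSpace {r : ℕ → FreeGroup α //
    r 0 = 1 ∧ ∀ i j, i ≤ j → ((r i)⁻¹ * r j).norm = j - i})

/-- The cylinder set `C(g)`: geodesic rays starting from the identity that contain `g`. -/
def rayCylinder {α : Type*} [DecidableEq α] (g : FreeGroup α) : Set (Boundary α) :=
  {r | ∃ k, r.1 k = g}

/-- The shadow of `g`: elements `g * y` with `|g * y| = |g| + |y|`, that is, elements whose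
reduced word starts with the reduced word of `g`. -/
def shadow {α : Type*} [DecidableEq α] (g : FreeGroup α) : Set (FreeGroup α) :=
  {x | x.norm = g.norm + (g⁻¹ * x).norm}

/-- Convergence of a sequence in `F` to a boundary point: the sequence eventually stays in the
shadow of every point of the ray (these shadows form a basis of neighbourhoods of the boundary
point in `F ∪ ∂F`, intersected with `F`). -/
def ConvergesTo {α : Type*} [DecidableEq α] (X : ℕ → FreeGroup α) (r : Boundary α) : Prop :=
  ∀ l : ℕ, ∀ᶠ k in atTop, X k ∈ shadow (r.1 l)

/-- The event that the walk started at the identity converges to a point of the boundary. -/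
def convergenceSet (α : Type*) [DecidableEq α] : Set (ℕ → FreeGroup α) :=
  {ω | ∃ r : Boundary α, ConvergesTo (walk 1 ω) r}

/-- The boundary point to which a convergent walk converges. -/
noncomputable def limitPoint {α : Type*} [DecidableEq α] (ω : convergenceSet α) : Boundary α :=
  ω.2.choose

/-- The hitting measure `ν_μ` on the boundary: the push-forward of the law of the walk started at
the identity under the map that sends a sample path to its limit. -/
noncomputable def hittingMeasure {α : Type*} [DecidableEq α] (μ : PMF (FreeGroup α)) :
    Measure (Boundary α) :=
  ((stepLaw μ).comap (Subtype.val : convergenceSet α → ℕ → FreeGroup α)).map limitPoint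

/-! ### The hitting measure is well defined -/

theorem norm_ray {α : Type*} [DecidableEq α] (r : Boundary α) (l : ℕ) : (r.1 l).norm = l := by
  have h := r.2.2 0 l (Nat.zero_le l)
  rw [r.2.1] at h
  simpa using h

theorem toWord_of_mem_shadow {α : Type*} [DecidableEq α] {g x : FreeGroup α}
    (h : x ∈ shadow g) : x.toWord = g.toWord ++ (g⁻¹ * x).toWord := by
  have h1 := FreeGroup.toWord_mul_sublist g (g⁻¹ * x)
  rw [mul_inv_cancel_left] at h1
  refine h1.eq_of_length ?_
  rw [List.length_append]
  exact h

theorem eq_of_mem_shadow {α : Type*} [DecidableEq α] {g g' x : FreeGroup α}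
    (h : x ∈ shadow g) (h' : x ∈ shadow g') (hn : g.norm = g'.norm) : g = g' := by
  have h1 := toWord_of_mem_shadow h
  rw [toWord_of_mem_shadow h'] at h1
  exact FreeGroup.toWord_injective (List.append_inj_left h1 hn.symm).symm

theorem ConvergesTo.unique {α : Type*} [DecidableEq α] {X : ℕ → FreeGroup α} {r r' : Boundary α}
    (h : ConvergesTo X r) (h' : ConvergesTo X r') : r = r' := by
  refine Subtype.ext (funext fun l => ?_)
  obtain ⟨k, hk, hk'⟩ := ((h l).and (h' l)).exists
  exact eq_of_mem_shadow hk hk' (by rw [norm_ray, norm_ray])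

theorem convergesTo_limitPoint {α : Type*} [DecidableEq α] (ω : convergenceSet α) :
    ConvergesTo (walk 1 ω.1) (limitPoint ω) :=
  ω.2.choose_spec

theorem measurable_walk {α : Type*} [Countable α] (x : FreeGroup α) (k : ℕ) :
    Measurable fun ω : ℕ → FreeGroup α => walk x ω k := by
  induction k with
  | zero => exact measurable_const
  | succ k ih =>
    exact (measurable_of_countable fun p : FreeGroup α × FreeGroup α => p.1 * p.2).comp
      (ih.prodMk (measurable_pi_apply k))

theorem measurableSet_eventually {α : Type*} [Countable α] (s : Set (FreeGroup α)) :
    MeasurableSet {ω : ℕ → FreeGroup α | ∀ᶠ k in atTop, walk 1 ω k ∈ s} := by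
  simp only [eventually_atTop, Set.ofPred_exists, Set.ofPred_forall]
  exact MeasurableSet.iUnion fun a => MeasurableSet.iInter fun k => MeasurableSet.iInter fun _ =>
    measurable_walk 1 k (MeasurableSet.of_discrete (s := s))

theorem exists_convergesTo_iff {α : Type*} [DecidableEq α] (X : ℕ → FreeGroup α) :
    (∃ r : Boundary α, ConvergesTo X r) ↔
      ∀ l : ℕ, ∃ g : FreeGroup α, g.norm = l ∧ ∀ᶠ k in atTop, X k ∈ shadow g := by
  constructor
  · rintro ⟨r, hr⟩ l
    exact ⟨r.1 l, norm_ray r l, hr l⟩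
  · intro h
    choose r hn hr using h
    have key : ∀ i j, i ≤ j → ((r i)⁻¹ * r j).norm = j - i := by
      intro i j hij
      obtain ⟨k, hi, hj⟩ := ((hr i).and (hr j)).exists
      have h1 := toWord_of_mem_shadow hi
      have h2 := toWord_of_mem_shadow hj
      rw [h1] at h2
      have hle : (r i).toWord.length ≤ (r j).toWord.length := by
        change (r i).norm ≤ (r j).norm
        rw [hn, hn]; exact hij
      have hp : (r i).toWord <+: (r j).toWord ++ ((r j)⁻¹ * X k).toWord :=
        h2 ▸ List.prefix_append _ _
      obtain ⟨t, ht⟩ := List.prefix_of_prefix_length_le hp (List.prefix_append _ _) hle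
      have hrj : r j = r i * FreeGroup.mk t := by
        rw [← FreeGroup.mk_toWord (x := r j), ← ht, ← FreeGroup.mul_mk, FreeGroup.mk_toWord]
      have hlen : (r i).toWord.length + t.length = (r j).toWord.length := by
        rw [← ht, List.length_append]
      have e1 : (r i).toWord.length = i := hn i
      have e2 : (r j).toWord.length = j := hn j
      have up : ((r i)⁻¹ * r j).norm ≤ t.length := by
        rw [hrj, inv_mul_cancel_left]; exact FreeGroup.norm_mk_le
      have lo := FreeGroup.norm_mul_le (r i) ((r i)⁻¹ * r j)
      rw [mul_inv_cancel_left, hn, hn] at lo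
      omega
    exact ⟨⟨r, FreeGroup.norm_eq_zero.1 (hn 0), key⟩, hr⟩

theorem measurableSet_convergenceSet {α : Type*} [DecidableEq α] [Countable α] :
    MeasurableSet (convergenceSet α) := by
  have : convergenceSet α = ⋂ l : ℕ, ⋃ g : FreeGroup α, ⋃ _ : g.norm = l,
      {ω | ∀ᶠ k in atTop, walk 1 ω k ∈ shadow g} := by
    ext ω
    simp only [convergenceSet, Set.mem_ofPred_eq, exists_convergesTo_iff, Set.mem_iInter,
      Set.mem_iUnion, exists_prop]
  rw [this]
  exact MeasurableSet.iInter fun l => MeasurableSet.iUnion fun g => MeasurableSet.iUnion fun _ =>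
    measurableSet_eventually _

theorem measurable_limitPoint {α : Type*} [DecidableEq α] [Countable α] :
    Measurable (limitPoint (α := α)) := by
  refine Measurable.subtype_mk (p := fun r : ℕ → FreeGroup α =>
    r 0 = 1 ∧ ∀ i j, i ≤ j → ((r i)⁻¹ * r j).norm = j - i)
    (f := fun ω => (limitPoint ω).1) (h := fun ω => (limitPoint ω).2) ?_
  refine measurable_pi_lambda _ fun l => measurable_to_countable' fun g => ?_
  by_cases hg : g.norm = l
  · have : (fun ω : convergenceSet α => (limitPoint ω).1 l) ⁻¹' {g} =
        Subtype.val ⁻¹' {ω | ∀ᶠ k in atTop, walk 1 ω k ∈ shadow g} := by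
      ext ω
      constructor
      · intro h
        have h' : (limitPoint ω).1 l = g := h
        have := convergesTo_limitPoint ω l
        rw [h'] at this
        exact this
      · intro h
        obtain ⟨k, h1, h2⟩ := ((convergesTo_limitPoint ω l).and h).exists
        exact eq_of_mem_shadow h1 h2 (by rw [norm_ray, hg])
    rw [this]
    exact measurable_subtype_coe (measurableSet_eventually _)
  · have : (fun ω : convergenceSet α => (limitPoint ω).1 l) ⁻¹' {g} = ∅ := by
      ext ω
      simp only [Set.mem_preimage, Set.mem_singleton_iff, Set.mem_empty_iff_false, iff_false]
      intro h
      exact hg (by rw [← h, norm_ray])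
    rw [this]
    exact MeasurableSet.empty

/-- The hitting measure of `A` is the probability that the walk started at the identity converges
to a point of `A`. -/
theorem hittingMeasure_apply {α : Type*} [DecidableEq α] [Countable α] (μ : PMF (FreeGroup α))
    {A : Set (Boundary α)} (hA : MeasurableSet A) :
    hittingMeasure μ A = stepLaw μ {ω | ∃ r ∈ A, ConvergesTo (walk 1 ω) r} := by
  rw [hittingMeasure, Measure.map_apply measurable_limitPoint hA,
    comap_subtype_coe_apply measurableSet_convergenceSet]
  congr 1
  ext ω
  constructor
  · rintro ⟨η, hη, rfl⟩
    exact ⟨_, hη, convergesTo_limitPoint η⟩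
  · rintro ⟨r, hr, h⟩
    refine ⟨⟨ω, r, h⟩, ?_, rfl⟩
    have := (convergesTo_limitPoint ⟨ω, r, h⟩).unique h
    simpa [Set.mem_preimage, this] using hr

end FreeGroupWalk

open FreeGroupWalk

/-!
# Decay of the first-passage function and the hitting measure

Write `a` for the generator `a i`, `A` for the set of its powers, and `F` for the first-passage
function from the identity. Since every increment is a power of a single generator, a path that
leaves `A` at `a ^ s` can come back to `A` only through `a ^ s`; so after its last visit to `A`, at
`a ^ s` say, the reduced words of the path keep the initial block `a ^ s`, and the limit lies in the
cylinder of `a` if and only if `0 < s` (`eventually_mem_shadow_iff`). By the strong Markov property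
at the first visit to `a ^ s`, the last visit is at `a ^ s` with probability `F (a ^ s) * c`, where
`c` does not depend on `s` (`stepLaw_lastVisit`). As `F (a ^ (-s)) = F (a ^ s)`, the hitting
measure `p` of the cylinder satisfies `p = c * ∑ k ≥ 1, F (a ^ k)` and
`1 - p = c * ∑ k ≥ 0, F (a ^ k)` (`hittingMeasure_rayCylinder`). Finally `F (a ^ k)` is
supermultiplicative in `k`, so Fekete's lemma gives `F (a ^ k) ≤ ρ ^ k`, and comparison with a
geometric series shows that the ratio of the two sums is at most `ρ`
(`tsum_firstPassage_succ_le`).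

Convergence to the boundary and the existence of a last visit to `A` both come from one function
that the transition operator multiplies by at most a constant `< 1` (`exists_contracted_weight`):
the product, over the syllables of a reduced word, of suitable factors `θ i < 1`. By Markov's
inequality the walk is, at time `k`, in a set where this function is bounded below with
exponentially small probability, so by Borel–Cantelli it visits such a set finitely often. Balls are
such sets, so the word length tends to infinity, and as the increments are bounded the initial
segments stabilize; `A` is another, because its elements have at most one syllable.
-/

namespace FreeGroupWalk

/-! ### The Markov property -/

section Markov

variable {α : Type*}

instance instIsProbabilityMeasureStepLaw (μ : PMF (FreeGroup α)) :
    IsProbabilityMeasure (stepLaw μ) := by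
  unfold stepLaw; infer_instance

/-- The sequence of increments whose first term is `g`, followed by `ω`. -/
def prepend (g : FreeGroup α) (ω : ℕ → FreeGroup α) : ℕ → FreeGroup α
  | 0 => g
  | k + 1 => ω k

/-- The event that the walk started at `x` visits `y` for the first time at time `k`. -/
def hitAt (x y : FreeGroup α) (k : ℕ) : Set (ℕ → FreeGroup α) :=
  {ω | walk x ω k = y ∧ ∀ j < k, walk x ω j ≠ y}

theorem walk_prepend (x g : FreeGroup α) (ω : ℕ → FreeGroup α) (k : ℕ) :
    walk x (prepend g ω) (k + 1) = walk (x * g) ω k := by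
  induction k with
  | zero => rfl
  | succ k ih => rw [walk, ih]; rfl

theorem walk_add (x : FreeGroup α) (ω : ℕ → FreeGroup α) (k l : ℕ) :
    walk x ω (k + l) = walk x ω k * walk 1 (fun j => ω (k + j)) l := by
  induction l with
  | zero => simp [walk]
  | succ l ih => rw [← add_assoc, walk, ih, walk, mul_assoc]

theorem prepend_mem_hitAt_succ (x y g : FreeGroup α) (ω : ℕ → FreeGroup α) (k : ℕ) :
    prepend g ω ∈ hitAt x y (k + 1) ↔ x ≠ y ∧ ω ∈ hitAt (x * g) y k := by
  simp only [hitAt, Set.mem_ofPred_eq, walk_prepend]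
  constructor
  · rintro ⟨h1, h2⟩
    exact ⟨h2 0 k.succ_pos, h1, fun j hj => walk_prepend x g ω j ▸ h2 (j + 1) (by omega)⟩
  · rintro ⟨h0, h1, h2⟩
    refine ⟨h1, fun j hj => ?_⟩
    cases j with
    | zero => exact h0
    | succ j => rw [walk_prepend]; exact h2 j (by omega)

theorem disjoint_hitAt (x y : FreeGroup α) : Pairwise (Function.onFun Disjoint (hitAt x y)) := by
  intro k l hkl
  refine Set.disjoint_left.2 fun ω hk hl => ?_
  rcases hkl.lt_or_gt with h | h
  · exact hl.2 k h hk.1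
  · exact hk.2 l h hl.1

theorem exists_mem_hitAt {x y : FreeGroup α} {ω : ℕ → FreeGroup α} {k : ℕ}
    (h : walk x ω k = y) : ∃ l ≤ k, ω ∈ hitAt x y l := by
  classical
  have hex : ∃ k, walk x ω k = y := ⟨k, h⟩
  exact ⟨Nat.find hex, Nat.find_min' hex h, Nat.find_spec hex, fun j hj => Nat.find_min hex hj⟩

theorem measurable_prepend :
    Measurable fun p : FreeGroup α × (ℕ → FreeGroup α) => prepend p.1 p.2 := by
  refine measurable_pi_lambda _ fun k => ?_
  cases k with
  | zero => exact measurable_fst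
  | succ k => exact (measurable_pi_apply k).comp measurable_snd

theorem measurable_shift (k : ℕ) :
    Measurable fun (ω : ℕ → FreeGroup α) (j : ℕ) => ω (k + j) :=
  measurable_pi_lambda _ fun j => measurable_pi_apply (k + j)

theorem ae_forall_step_ne_zero (μ : PMF (FreeGroup α)) :
    ∀ᵐ ω ∂stepLaw μ, ∀ k, μ (ω k) ≠ 0 := by
  refine ae_all_iff.2 fun k => ?_
  have h := measurePreserving_eval_infinitePi (fun _ : ℕ => μ.toMeasure) k
  refine h.quasiMeasurePreserving.ae (p := fun g => μ g ≠ 0) ?_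
  rw [ae_iff, PMF.toMeasure_apply_eq_zero_iff _ .of_discrete, Set.disjoint_left]
  intro g hg
  simpa using hg

/-- The increments of the walk are an independent first increment followed by a copy of the whole
sequence. -/
theorem map_prepend_stepLaw (μ : PMF (FreeGroup α)) :
    (μ.toMeasure.prod (stepLaw μ)).map (fun p => prepend p.1 p.2) = stepLaw μ := by
  refine Measure.eq_infinitePi _ fun s t ht => ?_
  classical
  obtain ⟨N, hN⟩ := s.exists_nat_subset_range
  -- Replace the index set `s` by an initial segment of `ℕ`.
  let u : ℕ → Set (FreeGroup α) := fun i => if i ∈ s then t i else Set.univ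
  have hu : Set.pi (s : Set ℕ) t = Set.pi (Finset.range (N + 1) : Set ℕ) u := by
    ext ω
    simp only [Set.mem_pi, Finset.mem_coe, u]
    constructor
    · intro h i _
      by_cases hi : i ∈ s
      · simpa [hi] using h i hi
      · simp [hi]
    · intro h i hi
      have := h i (Finset.range_mono N.le_succ (hN hi))
      simpa [hi] using this
  have hprod : ∏ i ∈ s, μ.toMeasure (t i) = ∏ i ∈ Finset.range (N + 1), μ.toMeasure (u i) := by
    rw [← Finset.prod_subset (hN.trans (Finset.range_mono N.le_succ))]
    · exact Finset.prod_congr rfl fun i hi => by simp [u, hi]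
    · intro i _ hi
      simp [u, hi]
  have hpre : (fun p : FreeGroup α × (ℕ → FreeGroup α) => prepend p.1 p.2) ⁻¹'
      Set.pi (Finset.range (N + 1) : Set ℕ) u =
      u 0 ×ˢ Set.pi (Finset.range N : Set ℕ) (fun i => u (i + 1)) := by
    ext ⟨g, ω⟩
    simp only [Set.mem_preimage, Set.mem_pi, Finset.mem_coe, Finset.mem_range, Set.mem_prod]
    constructor
    · intro h
      exact ⟨h 0 (by omega), fun i hi => h (i + 1) (by omega)⟩
    · rintro ⟨h0, h⟩ i hi
      cases i with
      | zero => exact h0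
      | succ i => exact h i (by omega)
  rw [hu, Measure.map_apply measurable_prepend
    (MeasurableSet.pi (Finset.countable_toSet _) fun _ _ => .of_discrete), hpre,
    Measure.prod_prod, stepLaw, Measure.infinitePi_pi _ fun _ _ => .of_discrete, hprod,
    Finset.prod_range_succ', mul_comm]

variable [Countable α]

/-- Conditioning on the first increment. -/
theorem lintegral_stepLaw (μ : PMF (FreeGroup α)) {f : (ℕ → FreeGroup α) → ℝ≥0∞}
    (hf : Measurable f) :
    ∫⁻ ω, f ω ∂stepLaw μ = ∑' g, μ g * ∫⁻ ω, f (prepend g ω) ∂stepLaw μ := by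
  conv_lhs => rw [← map_prepend_stepLaw]
  rw [lintegral_map hf measurable_prepend,
    lintegral_prod (fun p => f (prepend p.1 p.2)) (hf.comp measurable_prepend).aemeasurable,
    lintegral_countable']
  refine tsum_congr fun g => ?_
  rw [mul_comm, PMF.toMeasure_apply_singleton _ _ (MeasurableSet.singleton g)]

theorem stepLaw_apply (μ : PMF (FreeGroup α)) {A : Set (ℕ → FreeGroup α)} (hA : MeasurableSet A) :
    stepLaw μ A = ∑' g, μ g * stepLaw μ {ω | prepend g ω ∈ A} := by
  rw [← lintegral_indicator_one hA, lintegral_stepLaw μ (measurable_one.indicator hA)]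
  refine tsum_congr fun g => ?_
  congr 1
  rw [← lintegral_indicator_one]
  · rfl
  · exact (measurable_prepend.comp measurable_prodMk_left) hA

theorem measurableSet_hitAt (x y : FreeGroup α) (k : ℕ) : MeasurableSet (hitAt x y k) := by
  have : hitAt x y k = (fun ω => walk x ω k) ⁻¹' {y} ∩
      ⋂ j : ℕ, ⋂ _ : j < k, (fun ω => walk x ω j) ⁻¹' {y}ᶜ := by
    ext ω; simp [hitAt]
  rw [this]
  exact (measurable_walk x k .of_discrete).inter
    (.iInter fun j => .iInter fun _ => measurable_walk x j .of_discrete)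

/-- The strong Markov property at the first passage time. -/
theorem stepLaw_hitAt_inter_shift (μ : PMF (FreeGroup α)) {B : Set (ℕ → FreeGroup α)}
    (hB : MeasurableSet B) (x y : FreeGroup α) (k : ℕ) :
    stepLaw μ (hitAt x y k ∩ {ω | (fun j => ω (k + j)) ∈ B}) =
      stepLaw μ (hitAt x y k) * stepLaw μ B := by
  induction k generalizing x with
  | zero =>
    have h0 : ∀ ω : ℕ → FreeGroup α, ω ∈ hitAt x y 0 ↔ x = y := fun ω => by simp [hitAt, walk]
    by_cases hxy : x = y
    · have h1 : hitAt x y 0 = Set.univ := Set.eq_univ_of_forall fun ω => (h0 ω).2 hxy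
      have h2 : {ω : ℕ → FreeGroup α | (fun j => ω (0 + j)) ∈ B} = B := by
        ext ω; simp
      rw [h1, h2, Set.univ_inter, measure_univ, one_mul]
    · have h1 : hitAt x y 0 = ∅ := Set.eq_empty_of_forall_notMem fun ω h => hxy ((h0 ω).1 h)
      simp [h1]
  | succ k ih =>
    have hm : MeasurableSet (hitAt x y (k + 1) ∩ {ω | (fun j => ω (k + 1 + j)) ∈ B}) :=
      (measurableSet_hitAt x y _).inter (measurable_shift _ hB)
    rw [stepLaw_apply μ hm,
      stepLaw_apply μ (measurableSet_hitAt x y _), ← ENNReal.tsum_mul_right]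
    refine tsum_congr fun g => ?_
    rw [mul_assoc]
    congr 1
    by_cases hxy : x = y
    · simp [Set.mem_inter_iff, prepend_mem_hitAt_succ, hxy]
    · have h2 : {ω | prepend g ω ∈ hitAt x y (k + 1) ∩ {ω | (fun j => ω (k + 1 + j)) ∈ B}} =
          hitAt (x * g) y k ∩ {ω | (fun j => ω (k + j)) ∈ B} := by
        ext ω
        have h3 : (fun j => prepend g ω (k + 1 + j)) = fun j => ω (k + j) := by
          funext j
          rw [add_right_comm]; rfl
        simp only [Set.mem_inter_iff, Set.mem_ofPred_eq, prepend_mem_hitAt_succ, h3]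
        tauto
      have h4 : {ω | prepend g ω ∈ hitAt x y (k + 1)} = hitAt (x * g) y k := by
        ext ω
        simp [prepend_mem_hitAt_succ, hxy]
      rw [h2, h4, ih]

theorem stepLaw_iUnion_hitAt_inter_shift (μ : PMF (FreeGroup α)) {B : Set (ℕ → FreeGroup α)}
    (hB : MeasurableSet B) (x y : FreeGroup α) :
    stepLaw μ (⋃ k, hitAt x y k ∩ {ω | (fun j => ω (k + j)) ∈ B}) =
      firstPassage μ x y * stepLaw μ B := by
  rw [measure_iUnion, firstPassage, ← ENNReal.tsum_mul_right]
  · exact tsum_congr fun k => stepLaw_hitAt_inter_shift μ hB x y k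
  · exact fun k l hkl => (disjoint_hitAt x y hkl).mono Set.inter_subset_left Set.inter_subset_left
  · exact fun k => (measurableSet_hitAt x y k).inter (measurable_shift k hB)

/-- The first-passage function is the probability of ever visiting the target. -/
theorem firstPassage_eq (μ : PMF (FreeGroup α)) (x y : FreeGroup α) :
    firstPassage μ x y = stepLaw μ {ω | ∃ k, walk x ω k = y} := by
  have h := stepLaw_iUnion_hitAt_inter_shift μ MeasurableSet.univ x y
  rw [measure_univ, mul_one] at h
  rw [← h]
  congr 1
  ext ω
  simp only [Set.mem_iUnion, Set.mem_inter_iff, Set.mem_univ, Set.mem_ofPred_eq, and_true]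
  constructor
  · rintro ⟨k, hk⟩
    exact ⟨k, hk.1⟩
  · rintro ⟨k, hk⟩
    obtain ⟨l, -, hl⟩ := exists_mem_hitAt hk
    exact ⟨l, hl⟩

theorem firstPassage_le_one (μ : PMF (FreeGroup α)) (x y : FreeGroup α) :
    firstPassage μ x y ≤ 1 := by
  rw [firstPassage_eq]; exact prob_le_one

theorem firstPassage_self (μ : PMF (FreeGroup α)) (x : FreeGroup α) :
    firstPassage μ x x = 1 := by
  have : {ω : ℕ → FreeGroup α | ∃ k, walk x ω k = x} = Set.univ :=
    Set.eq_univ_of_forall fun ω => ⟨0, rfl⟩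
  rw [firstPassage_eq, this, measure_univ]

theorem firstPassage_mul_le (μ : PMF (FreeGroup α)) (g h : FreeGroup α) :
    firstPassage μ 1 g * firstPassage μ 1 h ≤ firstPassage μ 1 (g * h) := by
  have hB : MeasurableSet {ω : ℕ → FreeGroup α | ∃ k, walk 1 ω k = h} := by
    simp only [Set.ofPred_exists]
    exact .iUnion fun k => measurable_walk 1 k (MeasurableSet.singleton h)
  rw [firstPassage_eq μ 1 h, ← stepLaw_iUnion_hitAt_inter_shift μ hB, firstPassage_eq]
  refine measure_mono fun ω hω => ?_
  obtain ⟨k, hk, l, hl⟩ := Set.mem_iUnion.1 hω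
  exact ⟨k + l, by rw [walk_add, hk.1, hl]⟩

theorem le_firstPassage (μ : PMF (FreeGroup α)) (g : FreeGroup α) :
    μ g ≤ firstPassage μ 1 g := by
  have h := measurePreserving_eval_infinitePi (fun _ : ℕ => μ.toMeasure) 0
  rw [firstPassage_eq, ← PMF.toMeasure_apply_singleton μ g (MeasurableSet.singleton g),
    ← h.measure_preimage (MeasurableSet.singleton g).nullMeasurableSet]
  exact measure_mono fun ω hω => ⟨1, by simpa [walk] using hω⟩

theorem firstPassage_pow_ne_zero (μ : PMF (FreeGroup α)) {g : FreeGroup α} (hg : μ g ≠ 0) (k : ℕ) :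
    firstPassage μ 1 (g ^ k) ≠ 0 := by
  induction k with
  | zero => simp [firstPassage_self]
  | succ k ih =>
    have h1 : firstPassage μ 1 g ≠ 0 := fun h => hg (le_zero_iff.1 (h ▸ le_firstPassage μ g))
    intro h
    have := firstPassage_mul_le μ (g ^ k) g
    rw [← pow_succ, h, le_zero_iff, mul_eq_zero] at this
    exact this.elim ih h1

theorem firstPassage_map (μ : PMF (FreeGroup α)) (φ : FreeGroup α ≃* FreeGroup α)
    (hφ : ∀ g, μ (φ g) = μ g) (x y : FreeGroup α) :
    firstPassage μ (φ x) (φ y) = firstPassage μ x y := by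
  refine tsum_congr fun k => ?_
  change stepLaw μ (hitAt (φ x) (φ y) k) = stepLaw μ (hitAt x y k)
  induction k generalizing x with
  | zero => congr 1; ext ω; simp [hitAt, walk]
  | succ k ih =>
    rw [stepLaw_apply μ (measurableSet_hitAt _ _ _), stepLaw_apply μ (measurableSet_hitAt _ _ _),
      ← φ.toEquiv.tsum_eq]
    refine tsum_congr fun g => ?_
    have hg : φ.toEquiv g = φ g := rfl
    simp only [hg, hφ, prepend_mem_hitAt_succ, ← map_mul, ne_eq, φ.injective.eq_iff]
    by_cases hxy : x = y
    · simp [hxy]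
    · simpa [hxy] using congrArg (μ g * ·) (ih (x * g))

/-- A function that the transition operator contracts by a factor `c` is contracted by `c ^ k` over
`k` steps. -/
theorem lintegral_walk_le (μ : PMF (FreeGroup α)) {f : FreeGroup α → ℝ≥0∞} {c : ℝ≥0∞}
    (hf : ∀ x, ∑' g, μ g * f (x * g) ≤ c * f x) (x : FreeGroup α) (k : ℕ) :
    ∫⁻ ω, f (walk x ω k) ∂stepLaw μ ≤ c ^ k * f x := by
  induction k generalizing x with
  | zero => simp [walk]
  | succ k ih =>
    rw [lintegral_stepLaw μ (f := fun ω => f (walk x ω (k + 1)))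
      ((measurable_of_countable f).comp (measurable_walk x (k + 1)))]
    simp only [walk_prepend]
    calc ∑' g, μ g * ∫⁻ ω, f (walk (x * g) ω k) ∂stepLaw μ
        ≤ ∑' g, c ^ k * (μ g * f (x * g)) := by
          refine ENNReal.tsum_le_tsum fun g => ?_
          rw [mul_left_comm]
          gcongr
          exact ih _
      _ ≤ c ^ (k + 1) * f x := by
          rw [ENNReal.tsum_mul_left, pow_succ, mul_assoc]
          gcongr
          exact hf x

/-- If the transition operator contracts `f`, then the walk eventually leaves every set on which
`f` is bounded away from zero. -/
theorem ae_eventually_walk_notMem (μ : PMF (FreeGroup α)) {f : FreeGroup α → ℝ≥0∞} {c : ℝ≥0∞}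
    (hc : c < 1) (hf : ∀ x, ∑' g, μ g * f (x * g) ≤ c * f x) (hf1 : f 1 ≠ ∞)
    {s : Set (FreeGroup α)} {b : ℝ≥0∞} (hb : b ≠ 0) (hb' : b ≠ ∞) (hs : ∀ x ∈ s, b ≤ f x) :
    ∀ᵐ ω ∂stepLaw μ, ∀ᶠ k in atTop, walk 1 ω k ∉ s := by
  refine MeasureTheory.ae_eventually_notMem (s := fun k => {ω | walk 1 ω k ∈ s}) ?_
  have hle : ∀ k, stepLaw μ {ω | walk 1 ω k ∈ s} ≤ c ^ k * (f 1 / b) := by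
    intro k
    have h1 : b * stepLaw μ {ω | walk 1 ω k ∈ s} ≤ c ^ k * f 1 := by
      refine le_trans ?_ (lintegral_walk_le μ hf 1 k)
      refine le_trans ?_ (mul_meas_ge_le_lintegral
        ((measurable_of_countable f).comp (measurable_walk 1 k)) b)
      gcongr
      exact hs _
    rw [← mul_div_assoc, ENNReal.le_div_iff_mul_le (.inl hb) (.inl hb'), mul_comm]
    exact h1
  refine ne_top_of_le_ne_top ?_ (ENNReal.tsum_le_tsum hle)
  rw [ENNReal.tsum_mul_right, ENNReal.tsum_geometric]
  exact ENNReal.mul_ne_top (ENNReal.inv_ne_top.2 (tsub_pos_of_lt hc).ne')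
    (ENNReal.div_ne_top hf1 hb)

end Markov

/-! ### Syllables of reduced words -/

section Words

variable {α : Type*} [DecidableEq α]

open FreeGroup

/-- The generator that occurs (possibly inverted) at the beginning of the reduced word of `x`, if
`x ≠ 1`. -/
def firstGen (x : FreeGroup α) : Option α := x.toWord.head?.map Prod.fst

theorem toWord_of_zpow (i : α) (s : ℤ) :
    (of i ^ s).toWord = List.replicate s.natAbs (i, decide (0 ≤ s)) := by
  obtain ⟨k, rfl | rfl⟩ := s.eq_nat_or_neg
  · simp
  · rcases k.eq_zero_or_pos with rfl | hk
    · simp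
    · simp [toWord_inv, invRev]
      omega

theorem firstGen_one : firstGen (1 : FreeGroup α) = none := by simp [firstGen]

theorem firstGen_of_zpow (i : α) {s : ℤ} (hs : s ≠ 0) : firstGen (of i ^ s) = some i := by
  obtain ⟨k, hk⟩ := Nat.exists_eq_succ_of_ne_zero (Int.natAbs_ne_zero.2 hs)
  simp [firstGen, toWord_of_zpow, hk, List.replicate_succ]

theorem of_zpow_injective (i : α) : Function.Injective fun s : ℤ => of i ^ s := by
  intro s s' h
  by_contra hne
  have h1 := firstGen_of_zpow i (sub_ne_zero.2 hne)
  have h2 : of i ^ s = of i ^ s' := h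
  rw [zpow_sub, h2, mul_inv_cancel, firstGen_one] at h1
  cases h1

/-- Multiplying on the left by a power of `a i` concatenates reduced words when the right factor
does not start with `a i`. -/
theorem toWord_of_zpow_mul (i : α) (s : ℤ) {t : FreeGroup α} (ht : firstGen t ≠ some i) :
    (of i ^ s * t).toWord = (of i ^ s).toWord ++ t.toWord := by
  rw [toWord_mul, IsReduced.reduce_eq]
  refine List.IsChain.append isReduced_toWord isReduced_toWord fun a ha b hb hab => ?_
  rw [toWord_of_zpow] at ha
  have ha' := List.eq_of_mem_replicate (List.mem_of_mem_getLast? ha)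
  exact absurd (by simp [firstGen, Option.mem_def.1 hb, ← hab, ha']) ht

theorem firstGen_of_zpow_mul (i : α) {s : ℤ} (hs : s ≠ 0) {t : FreeGroup α}
    (ht : firstGen t ≠ some i) : firstGen (of i ^ s * t) = some i := by
  obtain ⟨k, hk⟩ := Nat.exists_eq_succ_of_ne_zero (Int.natAbs_ne_zero.2 hs)
  simp [firstGen, toWord_of_zpow_mul i s ht, toWord_of_zpow, hk, List.replicate_succ]

/-- Every element splits off a maximal power of `a i` on the left. -/
theorem exists_eq_of_zpow_mul (i : α) (x : FreeGroup α) :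
    ∃ (s : ℤ) (t : FreeGroup α), firstGen t ≠ some i ∧ x = of i ^ s * t := by
  induction hN : x.norm using Nat.strong_induction_on generalizing x with
  | _ N ih =>
    subst hN
    by_cases hx : firstGen x = some i
    · obtain ⟨⟨a, b⟩, L, hL⟩ : ∃ c L, x.toWord = c :: L := by
        cases h : x.toWord with
        | nil => simp [firstGen, h] at hx
        | cons c L => exact ⟨c, L, rfl⟩
      obtain rfl : a = i := by simpa [firstGen, hL] using hx
      have hx' : x = mk [(a, b)] * mk L := by
        rw [mul_mk, List.singleton_append, ← hL, mk_toWord]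
      have hlt : (mk L).norm < x.norm := by
        refine norm_mk_le.trans_lt ?_
        change _ < x.toWord.length
        simp [hL]
      obtain ⟨s, t, ht, hst⟩ := ih _ hlt _ rfl
      cases b with
      | true => exact ⟨1 + s, t, ht, by rw [hx', hst, zpow_add, zpow_one, mul_assoc]; rfl⟩
      | false =>
        exact ⟨-1 + s, t, ht, by rw [hx', hst, zpow_add, zpow_neg_one, mul_assoc]; rfl⟩
    · exact ⟨0, x, hx, by simp⟩

/-- A right factor `b ^ l` can change the first letter of `t` only if `t` is itself a power of `b`.
Hence `t * b ^ l` starts with `a i` only if `t` does, or if `t = 1` and `b = a i`. -/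
theorem firstGen_mul_of_zpow_ne {i b : α} {t : FreeGroup α} (ht : firstGen t ≠ some i) (l : ℤ)
    (h : t ≠ 1 ∨ b ≠ i) : firstGen (t * of b ^ l) ≠ some i := by
  obtain ⟨q, u, hu, hqu⟩ := exists_eq_of_zpow_mul b t⁻¹
  have ht' : t = u⁻¹ * of b ^ (-q) := by rw [← inv_inv t, hqu]; simp
  have hword : ∀ r : ℤ, (u⁻¹ * of b ^ r).toWord = u⁻¹.toWord ++ (of b ^ r).toWord := by
    intro r
    have h1 : u⁻¹ * of b ^ r = (of b ^ (-r) * u)⁻¹ := by simp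
    have h2 : of b ^ r = (of b ^ (-r))⁻¹ := by simp
    rw [h1, toWord_inv, toWord_of_zpow_mul b _ hu, h2, toWord_inv, toWord_inv]
    simp [invRev]
  by_cases hu1 : u = 1
  · subst hu1
    simp only [inv_one, one_mul] at ht'
    by_cases hbi : b = i
    · subst hbi
      by_cases hq : q = 0
      · simp [ht', hq] at h
      · exact absurd (ht' ▸ firstGen_of_zpow b (neg_ne_zero.2 hq)) ht
    · rw [ht', ← zpow_add]
      by_cases hs : -q + l = 0
      · simp [hs, firstGen_one]
      · rw [firstGen_of_zpow b hs]
        simpa using hbi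
  · have hne : u⁻¹.toWord ≠ [] := by rwa [ne_eq, toWord_eq_nil_iff, inv_eq_one]
    have key : ∀ r : ℤ, firstGen (u⁻¹ * of b ^ r) = firstGen u⁻¹ := by
      intro r
      rw [firstGen, hword, List.head?_append_of_ne_nil _ hne, firstGen]
    rw [ht', mul_assoc, ← zpow_add, key]
    rwa [ht', key] at ht

/-- The weight of a word: the product over its maximal blocks of powers of a single generator `i`
of the factor `θ i`. -/
def weight (θ : α → ℝ) : List (α × Bool) → ℝ
  | [] => 1
  | x :: l => if l.head?.map Prod.fst = some x.1 then weight θ l else θ x.1 * weight θ l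

theorem weight_pos {θ : α → ℝ} (hθ : ∀ i, 0 < θ i) (l : List (α × Bool)) : 0 < weight θ l := by
  induction l with
  | nil => exact one_pos
  | cons x l ih =>
    rw [weight]
    split_ifs
    · exact ih
    · exact mul_pos (hθ _) ih

theorem pow_length_le_weight {θ : α → ℝ} {c : ℝ} (hc : 0 ≤ c) (hc1 : c ≤ 1) (hθ : ∀ i, c ≤ θ i)
    (l : List (α × Bool)) : c ^ l.length ≤ weight θ l := by
  induction l with
  | nil => simp [weight]
  | cons x l ih =>
    rw [weight, List.length_cons, pow_succ']
    split_ifs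
    · exact (mul_le_of_le_one_left (pow_nonneg hc _) hc1).trans ih
    · exact mul_le_mul (hθ _) ih (pow_nonneg hc _) (hc.trans (hθ _))

theorem weight_of_zpow_mul (θ : α → ℝ) (i : α) {s : ℤ} (hs : s ≠ 0) {t : FreeGroup α}
    (ht : firstGen t ≠ some i) :
    weight θ (of i ^ s * t).toWord = θ i * weight θ t.toWord := by
  obtain ⟨k, hk⟩ := Nat.exists_eq_succ_of_ne_zero (Int.natAbs_ne_zero.2 hs)
  rw [toWord_of_zpow_mul i s ht, toWord_of_zpow, hk]
  generalize decide (0 ≤ s) = b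
  clear hk
  induction k with
  | zero =>
    rw [List.replicate_one, List.singleton_append, weight]
    exact if_neg ht
  | succ k ih =>
    rw [List.replicate_succ, List.cons_append, weight, ih, if_pos]
    simp [List.replicate_succ]

/-- Multiplying by `a i ^ j` and by `a i ^ (-j)`, on average, multiplies the weight by at most
`θ i` if the first syllable is not a power of `a i`, and by at most `(1 + 1 / θ i) / 2` otherwise:
at most one of the two products loses a syllable. -/
theorem weight_add_weight_le {θ : α → ℝ} (hθ : ∀ i, 0 < θ i) (hθ1 : ∀ i, θ i ≤ 1) (i : α) {j : ℤ}
    (hj : j ≠ 0) (x : FreeGroup α) :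
    weight θ (of i ^ j * x).toWord + weight θ ((of i ^ j)⁻¹ * x).toWord ≤
      2 * (weight θ x.toWord * if firstGen x = some i then (1 + 1 / θ i) / 2 else θ i) := by
  obtain ⟨s, t, ht, rfl⟩ := exists_eq_of_zpow_mul i x
  rw [← zpow_neg, ← mul_assoc, ← mul_assoc, ← zpow_add, ← zpow_add]
  have hw := weight_pos hθ t.toWord
  by_cases hs : s = 0
  · subst hs
    rw [add_zero, add_zero, weight_of_zpow_mul θ i hj ht,
      weight_of_zpow_mul θ i (neg_ne_zero.2 hj) ht, zpow_zero, one_mul, if_neg ht]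
    linarith
  · rw [weight_of_zpow_mul θ i hs ht, if_pos (firstGen_of_zpow_mul i hs ht)]
    have hrhs : 2 * (θ i * weight θ t.toWord * ((1 + 1 / θ i) / 2)) =
        θ i * weight θ t.toWord + weight θ t.toWord := by
      have := (hθ i).ne'
      field_simp
    rw [hrhs]
    have hle : ∀ r : ℤ, weight θ (of i ^ r * t).toWord ≤ weight θ t.toWord := by
      intro r
      by_cases hr : r = 0
      · simp [hr]
      · rw [weight_of_zpow_mul θ i hr ht]
        exact mul_le_of_le_one_left hw.le (hθ1 i)
    by_cases h1 : j + s = 0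
    · have h2 : -j + s ≠ 0 := by omega
      rw [weight_of_zpow_mul θ i h2 ht, add_comm]
      gcongr
      exact hle _
    · rw [weight_of_zpow_mul θ i h1 ht]
      gcongr
      exact hle _

/-! ### Prefixes of reduced words -/

theorem mem_shadow_iff {g x : FreeGroup α} : x ∈ shadow g ↔ g.toWord <+: x.toWord := by
  constructor
  · exact fun h => ⟨_, (toWord_of_mem_shadow h).symm⟩
  · rintro ⟨t, ht⟩
    have h1 : g⁻¹ * x = mk t := by
      rw [inv_mul_eq_iff_eq_mul, ← mk_toWord (x := x), ← ht, ← mul_mk, mk_toWord]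
    have h2 : (mk t).toWord = t :=
      ((isReduced_toWord (x := x)).infix (ht ▸ (List.suffix_append _ _).isInfix)).reduce_eq
    change x.toWord.length = g.toWord.length + (g⁻¹ * x).toWord.length
    rw [h1, h2, ← ht, List.length_append]

/-- Multiplication by a letter on the right appends it to the reduced word or cancels the last
letter. -/
theorem toWord_mul_letter (x : FreeGroup α) (c : α × Bool) :
    (x * mk [c]).toWord = x.toWord ++ [c] ∨ ∃ d, x.toWord = (x * mk [c]).toWord ++ [d] := by
  have hx : x * mk [c] = mk (x.toWord ++ [c]) := by rw [← mul_mk, mk_toWord]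
  by_cases hred : IsReduced (x.toWord ++ [c])
  · left
    rw [hx]
    exact hred.reduce_eq
  · right
    rcases List.eq_nil_or_concat x.toWord with h | ⟨W, d, h⟩
    · exact absurd (by rw [h]; exact IsReduced.singleton) hred
    · rw [List.concat_eq_append] at h
      have hW : IsReduced (W ++ [d]) := h ▸ isReduced_toWord
      have hcd : d = (c.1, !c.2) := by
        by_contra hne
        refine hred (List.IsChain.append isReduced_toWord IsReduced.singleton fun a ha b hb hab => ?_)
        simp only [h, List.getLast?_append, List.getLast?_singleton, Option.some_or,
          Option.mem_def, Option.some.injEq] at ha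
        simp only [List.head?_cons, Option.mem_def, Option.some.injEq] at hb
        subst ha hb
        by_contra h2
        exact hne (Prod.ext hab (by simpa using Bool.eq_not.2 h2))
      refine ⟨d, ?_⟩
      have h3 : x * mk [c] = mk W := by
        rw [hx, h, hcd, List.append_assoc]
        exact Quot.sound (by simpa using Red.Step.not_rev (L₁ := W) (L₂ := []) (x := c.1) (b := c.2))
      rw [h3, h]
      congr 1
      exact (hW.infix (List.prefix_append _ _).isInfix).reduce_eq.symm

theorem prefix_toWord_mul_letter_pow {x : FreeGroup α} {p : List (α × Bool)}
    (hp : p <+: x.toWord) (c : α × Bool) {k : ℕ} (hk : p.length + k ≤ x.norm) :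
    p <+: (x * mk [c] ^ k).toWord := by
  induction k generalizing x with
  | zero => simpa using hp
  | succ k ih =>
    rw [pow_succ', ← mul_assoc]
    change _ ≤ x.toWord.length at hk
    rcases toWord_mul_letter x c with h | ⟨d, h⟩
    · refine ih (h ▸ hp.trans (List.prefix_append _ _)) ?_
      change _ ≤ (x * mk [c]).toWord.length
      rw [h, List.length_append]
      omega
    · have hlen : x.toWord.length = (x * mk [c]).toWord.length + 1 := by
        conv_lhs => rw [h]
        simp
      refine ih (List.prefix_of_prefix_length_le hp (h ▸ List.prefix_append _ _) (by omega)) ?_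
      change _ ≤ (x * mk [c]).toWord.length
      omega

/-- A power of a generator on the right only affects the end of a reduced word. -/
theorem prefix_toWord_mul_of_zpow {x : FreeGroup α} {p : List (α × Bool)} (hp : p <+: x.toWord)
    (i : α) {j : ℤ} (hj : p.length + j.natAbs ≤ x.norm) : p <+: (x * of i ^ j).toWord := by
  obtain ⟨k, rfl | rfl⟩ := j.eq_nat_or_neg
  · rw [zpow_natCast]
    exact prefix_toWord_mul_letter_pow hp (i, true) (by simpa using hj)
  · rw [zpow_neg, zpow_natCast, ← inv_pow]
    exact prefix_toWord_mul_letter_pow hp (i, false) (by simpa using hj)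

end Words

/-! ### A weight contracted by the transition operator -/

section Contraction

open FreeGroup

variable {α : Type*} [DecidableEq α] [Fintype α]

/-- The expected factor by which a step changes the weight; `o` is the generator of the syllable that
the step may cancel. -/
theorem sum_mul_le_one_sub {P θ : α → ℝ} {t : ℝ} (hα : 2 ≤ Fintype.card α) (ht : 0 < t)
    (hP : ∀ i, 3 * t ≤ P i) (hsum : ∑ i, P i = 1) (hθ : ∀ i, θ i = 1 - t / P i) (o : Option α) :
    ∑ i, P i * (if o = some i then (1 + 1 / θ i) / 2 else θ i) ≤ 1 - t / 4 := by
  have hterm : ∀ i, P i * (if o = some i then (1 + 1 / θ i) / 2 else θ i) ≤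
      P i - t + if o = some i then 7 / 4 * t else 0 := by
    intro i
    have hPi : 0 < P i := by linarith [hP i]
    have hPθ : P i * θ i = P i - t := by rw [hθ]; field_simp
    split_ifs with h
    · have hθi : 0 < θ i := by
        by_contra hneg
        nlinarith [hP i]
      -- As `t ≤ P i / 3`, one has `θ i ≥ 2 / 3`, hence `1 / θ i ≤ 1 + (3 / 2) * (1 - θ i)`.
      have h1 : P i * (1 / θ i) ≤ P i + 3 / 2 * t := by
        rw [mul_one_div, div_le_iff₀ hθi]
        nlinarith [hP i]
      linarith
    · linarith
  refine (Finset.sum_le_sum fun i _ => hterm i).trans ?_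
  have h2 : ∑ i, (if o = some i then 7 / 4 * t else 0) ≤ 7 / 4 * t := by
    cases o with
    | none => simp; linarith
    | some k => simp
  have h3 : (2 : ℝ) ≤ Fintype.card α := by exact_mod_cast hα
  rw [Finset.sum_add_distrib, Finset.sum_sub_distrib, hsum, Finset.sum_const, Finset.card_univ,
    nsmul_eq_mul]
  nlinarith

/-- If each generator `a i` carries the mass `P i` of its powers, the weight with factors
`θ i = 1 - t / P i` is contracted by the transition operator for small `t`. In the first order
in `t`, a step along a new generator `i` lowers the expected weight by `t`, while the steps along
the generator of the last syllable raise it by at most `t / 2`, because by symmetry they cancel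
this syllable with conditional probability at most `1 / 2`. -/
theorem exists_contracted_weight (hα : 2 ≤ Fintype.card α) (μ : PMF (FreeGroup α))
    (hsymm : ∀ g, μ g⁻¹ = μ g) (hsupp : ∀ g, μ g ≠ 0 → ∃ (i : α) (j : ℤ), j ≠ 0 ∧ g = of i ^ j)
    (hpos : ∀ i, μ (of i) ≠ 0) :
    ∃ (c : ℝ≥0∞) (θ : α → ℝ), c < 1 ∧ (∀ i, 0 < θ i) ∧ (∀ i, θ i ≤ 1) ∧
      ∀ x, ∑' g, μ g * ENNReal.ofReal (weight θ (x * g)⁻¹.toWord) ≤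
        c * ENNReal.ofReal (weight θ x⁻¹.toWord) := by
  let p : α → ℝ≥0∞ := fun i => ∑' g, if firstGen g = some i then μ g else 0
  have hsplit : ∀ g, ∑ i, (if firstGen g = some i then μ g else 0) = μ g := by
    intro g
    by_cases hg : μ g = 0
    · simp [hg]
    · obtain ⟨i, j, hj, rfl⟩ := hsupp g hg
      simp [firstGen_of_zpow i hj]
  have hp1 : ∑ i, p i = 1 := by
    rw [← μ.tsum_coe, ← Summable.tsum_finsetSum fun _ _ => ENNReal.summable]
    exact tsum_congr hsplit
  have hpt : ∀ i, p i ≠ ∞ := fun i =>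
    ne_top_of_le_ne_top ENNReal.one_ne_top
      (hp1 ▸ Finset.single_le_sum (fun _ _ => zero_le) (Finset.mem_univ i))
  have hp0 : ∀ i, p i ≠ 0 := by
    intro i h
    have h1 := ENNReal.tsum_eq_zero.1 h (of i)
    rw [if_pos (by simpa using firstGen_of_zpow i one_ne_zero)] at h1
    exact hpos i h1
  let P : α → ℝ := fun i => (p i).toReal
  have hP0 : ∀ i, 0 < P i := fun i => ENNReal.toReal_pos (hp0 i) (hpt i)
  have hPsum : ∑ i, P i = 1 := by
    rw [← ENNReal.toReal_sum fun i _ => hpt i, hp1, ENNReal.toReal_one]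
  have hne : (Finset.univ : Finset α).Nonempty :=
    Finset.card_pos.1 (by rw [Finset.card_univ]; omega)
  obtain ⟨k, -, hk⟩ := Finset.exists_min_image Finset.univ P hne
  let t : ℝ := P k / 3
  have ht : 0 < t := div_pos (hP0 k) three_pos
  have hPt : ∀ i, 3 * t ≤ P i := fun i => by
    have := hk i (Finset.mem_univ i)
    simp only [t]
    linarith
  have ht4 : t < 4 := by
    have := Finset.single_le_sum (fun i _ => (hP0 i).le) (Finset.mem_univ k)
    rw [hPsum] at this
    simp only [t]
    linarith
  let θ : α → ℝ := fun i => 1 - t / P i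
  have hθ : ∀ i, 0 < θ i := fun i => by
    have : t / P i < 1 := (div_lt_one (hP0 i)).2 (by linarith [hPt i])
    simp only [θ]
    linarith
  have hθ1 : ∀ i, θ i ≤ 1 := fun i => by
    have : 0 < t / P i := div_pos ht (hP0 i)
    simp only [θ]
    linarith
  refine ⟨ENNReal.ofReal (1 - t / 4), θ, ?_, hθ, hθ1, fun x => ?_⟩
  · rw [ENNReal.ofReal_lt_one]
    linarith
  let y := x⁻¹
  let f : FreeGroup α → ℝ≥0∞ := fun z => ENNReal.ofReal (weight θ z.toWord)
  let β : α → ℝ := fun i => if firstGen y = some i then (1 + 1 / θ i) / 2 else θ i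
  have hβ : ∀ i, 0 ≤ β i := by
    intro i
    have := hθ i
    simp only [β]
    split_ifs <;> positivity
  have hw := weight_pos hθ y.toWord
  have hinv : ∑' g, μ g * f (g⁻¹ * y) = ∑' g, μ g * f (g * y) := by
    rw [← (Equiv.inv (FreeGroup α)).tsum_eq]
    simp [hsymm]
  have hbound : ∀ g, μ g * f (g * y) + μ g * f (g⁻¹ * y) ≤
      ∑ i, (if firstGen g = some i then μ g else 0) *
        ENNReal.ofReal (2 * (weight θ y.toWord * β i)) := by
    intro g
    by_cases hg : μ g = 0
    · simp [hg]
    · obtain ⟨i, j, hj, rfl⟩ := hsupp g hg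
      rw [Finset.sum_eq_single i (fun i' _ hi' => by simp [firstGen_of_zpow i hj, hi'.symm])
        (by simp), if_pos (firstGen_of_zpow i hj), ← mul_add,
        ← ENNReal.ofReal_add (weight_pos hθ _).le (weight_pos hθ _).le]
      gcongr
      exact weight_add_weight_le hθ hθ1 i hj y
  have htwo : 2 * ∑' g, μ g * f (g⁻¹ * y) ≤
      2 * (ENNReal.ofReal (1 - t / 4) * f y) := by
    calc 2 * ∑' g, μ g * f (g⁻¹ * y)
        = ∑' g, (μ g * f (g * y) + μ g * f (g⁻¹ * y)) := by
          rw [ENNReal.tsum_add, ← hinv, two_mul]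
      _ ≤ ∑' g, ∑ i, (if firstGen g = some i then μ g else 0) *
            ENNReal.ofReal (2 * (weight θ y.toWord * β i)) := ENNReal.tsum_le_tsum hbound
      _ = ∑ i, p i * ENNReal.ofReal (2 * (weight θ y.toWord * β i)) := by
          rw [Summable.tsum_finsetSum fun _ _ => ENNReal.summable]
          exact Finset.sum_congr rfl fun i _ => ENNReal.tsum_mul_right
      _ = ENNReal.ofReal (2 * (weight θ y.toWord * ∑ i, P i * β i)) := by
          rw [Finset.mul_sum, Finset.mul_sum, ENNReal.ofReal_sum_of_nonneg fun i _ => by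
            have := hβ i; have := hP0 i; positivity]
          refine Finset.sum_congr rfl fun i _ => ?_
          rw [← ENNReal.ofReal_toReal (hpt i), ← ENNReal.ofReal_mul ENNReal.toReal_nonneg]
          congr 1
          change P i * _ = _
          ring
      _ ≤ ENNReal.ofReal (2 * (weight θ y.toWord * (1 - t / 4))) := by
          gcongr
          exact sum_mul_le_one_sub hα ht hPt hPsum (fun _ => rfl) _
      _ = 2 * (ENNReal.ofReal (1 - t / 4) * f y) := by
          rw [ENNReal.ofReal_mul two_pos.le, mul_comm (weight θ y.toWord),
            ENNReal.ofReal_mul (by linarith), ENNReal.ofReal_ofNat]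
  have := (ENNReal.mul_le_mul_iff_right two_ne_zero ENNReal.ofNat_ne_top).1 htwo
  simpa only [f, y, mul_inv_rev] using this

end Contraction

/-! ### Transience and convergence to the boundary -/

section Convergence

open FreeGroup

variable {α : Type*} [DecidableEq α]

/-- A sequence in the free group that escapes to infinity and moves by bounded powers of generators
converges to a boundary point. -/
theorem exists_convergesTo_of_tendsto_norm {X : ℕ → FreeGroup α} {N : ℕ}
    (hstep : ∀ k, ∃ (i : α) (j : ℤ), j.natAbs ≤ N ∧ X (k + 1) = X k * of i ^ j)
    (hX : Tendsto (fun k => (X k).norm) atTop atTop) : ∃ r : Boundary α, ConvergesTo X r := by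
  rw [exists_convergesTo_iff]
  intro l
  obtain ⟨K, hK⟩ := eventually_atTop.1 (hX.eventually_ge_atTop (l + N))
  have hword : (mk ((X K).toWord.take l)).toWord = (X K).toWord.take l :=
    (isReduced_toWord.infix (List.take_prefix l (X K).toWord).isInfix).reduce_eq
  have hlen : ((X K).toWord.take l).length = l := by
    have h1 : l + N ≤ (X K).toWord.length := hK K le_rfl
    rw [List.length_take]
    omega
  refine ⟨mk ((X K).toWord.take l), ?_, eventually_atTop.2 ⟨K, fun k hk => ?_⟩⟩
  · rw [FreeGroup.norm, hword, hlen]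
  · rw [mem_shadow_iff, hword]
    induction k, hk using Nat.le_induction with
    | base => exact List.take_prefix l _
    | succ k hk ih =>
      obtain ⟨i, j, hj, hij⟩ := hstep k
      rw [hij]
      refine prefix_toWord_mul_of_zpow ih i ?_
      have := hK k hk
      omega

variable [Fintype α]

theorem ae_eventually_notMem_powers (hα : 2 ≤ Fintype.card α) (μ : PMF (FreeGroup α))
    (hsymm : ∀ g, μ g⁻¹ = μ g) (hsupp : ∀ g, μ g ≠ 0 → ∃ (i : α) (j : ℤ), j ≠ 0 ∧ g = of i ^ j)
    (hpos : ∀ i, μ (of i) ≠ 0) (i : α) :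
    ∀ᵐ ω ∂stepLaw μ, ∀ᶠ k in atTop, walk 1 ω k ∉ Set.range fun s : ℤ => of i ^ s := by
  obtain ⟨c, θ, hc, hθ, hθ1, hcontr⟩ := exists_contracted_weight hα μ hsymm hsupp hpos
  refine ae_eventually_walk_notMem μ hc hcontr ENNReal.ofReal_ne_top
    (ENNReal.ofReal_pos.2 (hθ i)).ne' ENNReal.ofReal_ne_top ?_
  rintro - ⟨s, rfl⟩
  refine ENNReal.ofReal_le_ofReal ?_
  -- The inverse of a power of `a i` has at most one syllable.
  rw [← zpow_neg]
  by_cases hs : s = 0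
  · simpa [hs, weight] using hθ1 i
  · have h1 := weight_of_zpow_mul θ i (neg_ne_zero.2 hs) (t := 1) (by simp [firstGen_one])
    rw [mul_one, toWord_one, weight, mul_one] at h1
    exact h1.ge

theorem ae_tendsto_norm_walk (hα : 2 ≤ Fintype.card α) (μ : PMF (FreeGroup α))
    (hsymm : ∀ g, μ g⁻¹ = μ g) (hsupp : ∀ g, μ g ≠ 0 → ∃ (i : α) (j : ℤ), j ≠ 0 ∧ g = of i ^ j)
    (hpos : ∀ i, μ (of i) ≠ 0) :
    ∀ᵐ ω ∂stepLaw μ, Tendsto (fun k => (walk 1 ω k).norm) atTop atTop := by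
  obtain ⟨c, θ, hc, hθ, hθ1, hcontr⟩ := exists_contracted_weight hα μ hsymm hsupp hpos
  have hne : (Finset.univ : Finset α).Nonempty :=
    Finset.card_pos.1 (by rw [Finset.card_univ]; omega)
  obtain ⟨k, -, hk⟩ := Finset.exists_min_image Finset.univ θ hne
  have hball : ∀ R : ℕ, ∀ᵐ ω ∂stepLaw μ, ∀ᶠ k in atTop,
      walk 1 ω k ∉ {x : FreeGroup α | x.norm ≤ R} := by
    intro R
    refine ae_eventually_walk_notMem μ hc hcontr ENNReal.ofReal_ne_top
      (ENNReal.ofReal_pos.2 (pow_pos (hθ k) R)).ne' ENNReal.ofReal_ne_top fun x hx => ?_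
    refine ENNReal.ofReal_le_ofReal ?_
    refine le_trans ?_ (pow_length_le_weight (hθ k).le (hθ1 k) (fun i => hk i (Finset.mem_univ i)) _)
    refine pow_le_pow_of_le_one (hθ k).le (hθ1 k) ?_
    change x⁻¹.norm ≤ R
    rwa [norm_inv_eq]
  filter_upwards [ae_all_iff.2 hball] with ω hω
  refine tendsto_atTop.2 fun R => (hω R).mono fun k hk => ?_
  exact (not_le.1 hk).le

theorem ae_exists_convergesTo (hα : 2 ≤ Fintype.card α) (μ : PMF (FreeGroup α))
    (hsymm : ∀ g, μ g⁻¹ = μ g) {N : ℕ}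
    (hsupp : ∀ g, μ g ≠ 0 → ∃ (i : α) (j : ℤ), j ≠ 0 ∧ j.natAbs ≤ N ∧ g = of i ^ j)
    (hpos : ∀ i, μ (of i) ≠ 0) :
    ∀ᵐ ω ∂stepLaw μ, ∃ r : Boundary α, ConvergesTo (walk 1 ω) r := by
  have hsupp' : ∀ g, μ g ≠ 0 → ∃ (i : α) (j : ℤ), j ≠ 0 ∧ g = of i ^ j := fun g hg =>
    let ⟨i, j, hj, _, h⟩ := hsupp g hg
    ⟨i, j, hj, h⟩
  filter_upwards [ae_tendsto_norm_walk hα μ hsymm hsupp' hpos, ae_forall_step_ne_zero μ]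
    with ω h1 h2
  refine exists_convergesTo_of_tendsto_norm (N := N) (fun k => ?_) h1
  obtain ⟨i, j, -, hj, h⟩ := hsupp _ (h2 k)
  exact ⟨i, j, hj, by rw [walk, h]⟩

end Convergence

/-! ### The last visit to the powers of a generator -/

section LastVisit

open FreeGroup

variable {α : Type*}

/-- The event that the walk started at the identity visits the powers of `a i` for the last time at
`y`. -/
def lastVisit (i : α) (y : FreeGroup α) : Set (ℕ → FreeGroup α) :=
  {ω | ∃ K, walk 1 ω K = y ∧ ∀ k > K, walk 1 ω k ∉ Set.range fun s : ℤ => of i ^ s}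

theorem lastVisit_of_zpow (i : α) (s : ℤ) :
    lastVisit i (of i ^ s) =
      ⋃ k, hitAt 1 (of i ^ s) k ∩ {ω | (fun j => ω (k + j)) ∈ lastVisit i 1} := by
  have hmem : ∀ z : FreeGroup α, of i ^ s * z ∈ Set.range (fun s : ℤ => of i ^ s) ↔
      z ∈ Set.range fun s : ℤ => of i ^ s := by
    intro z
    constructor
    · rintro ⟨r, hr⟩
      refine ⟨-s + r, ?_⟩
      change of i ^ (-s + r) = z
      rw [zpow_add, zpow_neg, inv_mul_eq_iff_eq_mul]
      exact hr
    · rintro ⟨r, rfl⟩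
      exact ⟨s + r, zpow_add _ _ _⟩
  ext ω
  simp only [Set.mem_iUnion, Set.mem_inter_iff, Set.mem_ofPred_eq]
  constructor
  · rintro ⟨K, hK, hlast⟩
    obtain ⟨k, hk, hhit⟩ := exists_mem_hitAt hK
    refine ⟨k, hhit, K - k, ?_, fun l hl => ?_⟩
    · have h1 := walk_add 1 ω k (K - k)
      rw [Nat.add_sub_cancel' hk, hK, hhit.1] at h1
      exact mul_eq_left.1 h1.symm
    · rw [← hmem, ← hhit.1, ← walk_add]
      exact hlast _ (by omega)
  · rintro ⟨k, hhit, K, hK, hlast⟩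
    refine ⟨k + K, by rw [walk_add, hK, hhit.1, mul_one], fun l hl => ?_⟩
    obtain ⟨l, rfl⟩ := Nat.exists_eq_add_of_le (by omega : k ≤ l)
    rw [walk_add, hhit.1, hmem]
    exact hlast l (by omega)

theorem disjoint_lastVisit [DecidableEq α] (i : α) :
    Pairwise (Function.onFun Disjoint fun s : ℤ => lastVisit i (of i ^ s)) := by
  intro s s' hne
  refine Set.disjoint_left.2 ?_
  rintro ω ⟨K, hK, hlast⟩ ⟨K', hK', hlast'⟩
  rcases lt_trichotomy K K' with h | rfl | h
  · exact hlast K' h ⟨s', hK'.symm⟩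
  · exact hne (of_zpow_injective i (hK.symm.trans hK'))
  · exact hlast' K h ⟨s, hK.symm⟩

/-- A walk that eventually avoids the powers of `a i` has a last visit to them, because it starts
at `a i ^ 0`. -/
theorem exists_mem_lastVisit (i : α) {ω : ℕ → FreeGroup α}
    (h : ∀ᶠ k in atTop, walk 1 ω k ∉ Set.range fun s : ℤ => of i ^ s) :
    ∃ s : ℤ, ω ∈ lastVisit i (of i ^ s) := by
  classical
  obtain ⟨K, hK⟩ := eventually_atTop.1 h
  have h0 : walk 1 ω 0 ∈ Set.range fun s : ℤ => of i ^ s := ⟨0, zpow_zero _⟩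
  have hspec := Nat.findGreatest_spec
    (P := fun k => walk 1 ω k ∈ Set.range fun s : ℤ => of i ^ s) (Nat.zero_le K) h0
  obtain ⟨s, hs⟩ := hspec
  refine ⟨s, _, hs.symm, fun k hk hmem => ?_⟩
  rcases le_or_gt K k with h1 | h1
  · exact hK k h1 hmem
  · exact Nat.findGreatest_is_greatest hk h1.le hmem

/-- After its last visit at `a i ^ s` to the powers of `a i`, the walk keeps the maximal initial
power `a i ^ s`. -/
theorem eventually_mem_shadow_iff [DecidableEq α] (i : α) {s : ℤ} {ω : ℕ → FreeGroup α}
    (hstep : ∀ k, ∃ (b : α) (j : ℤ), ω k = of b ^ j) (h : ω ∈ lastVisit i (of i ^ s)) :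
    (∀ᶠ k in atTop, walk 1 ω k ∈ shadow (of i)) ↔ 0 < s := by
  obtain ⟨K, hK, hlast⟩ := h
  have hdecomp : ∀ k ≥ K, ∃ t, firstGen t ≠ some i ∧ walk 1 ω k = of i ^ s * t := by
    intro k hk
    induction k, hk using Nat.le_induction with
    | base => exact ⟨1, by simp [firstGen_one], by rw [hK, mul_one]⟩
    | succ k hk ih =>
      obtain ⟨t, ht, hkt⟩ := ih
      obtain ⟨b, j, hbj⟩ := hstep k
      have hwalk : walk 1 ω (k + 1) = of i ^ s * (t * of b ^ j) := by
        rw [walk, hkt, hbj, mul_assoc]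
      refine ⟨t * of b ^ j, firstGen_mul_of_zpow_ne ht j ?_, hwalk⟩
      by_contra! hcon
      obtain ⟨rfl, rfl⟩ := hcon
      refine hlast (k + 1) (by omega) ⟨s + j, ?_⟩
      rw [hwalk, one_mul]
      exact zpow_add _ _ _
  have hiff : ∀ k ≥ K, (walk 1 ω k ∈ shadow (of i) ↔ 0 < s) := by
    intro k hk
    obtain ⟨t, ht, hkt⟩ := hdecomp k hk
    rw [hkt, mem_shadow_iff, toWord_of_zpow_mul i s ht, toWord_of_zpow, toWord_of,
      List.singleton_prefix_iff_head?_eq_some]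
    rcases lt_trichotomy s 0 with hs | rfl | hs
    · obtain ⟨n, hn⟩ := Nat.exists_eq_succ_of_ne_zero (Int.natAbs_ne_zero.2 hs.ne)
      simp [hn, List.replicate_succ, hs.not_ge, hs.not_gt]
    · simp only [Int.natAbs_zero, List.replicate_zero, List.nil_append, lt_irrefl, iff_false]
      exact fun hhead => ht (by simp [firstGen, hhead])
    · obtain ⟨n, hn⟩ := Nat.exists_eq_succ_of_ne_zero (Int.natAbs_ne_zero.2 hs.ne')
      simp [hn, List.replicate_succ, hs.le, hs]
  constructor
  · intro hev
    obtain ⟨k, hk, hkK⟩ := (hev.and (eventually_ge_atTop K)).exists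
    exact (hiff k hkK).1 hk
  · exact fun hs => eventually_atTop.2 ⟨K, fun k hk => (hiff k hk).2 hs⟩

theorem measurableSet_rayCylinder [DecidableEq α] (g : FreeGroup α) :
    MeasurableSet (rayCylinder g) := by
  have : rayCylinder g = ⋃ k : ℕ, (fun r : Boundary α => r.1 k) ⁻¹' {g} := by
    ext r
    simp [rayCylinder]
  rw [this]
  exact .iUnion fun k => ((measurable_pi_apply k).comp measurable_subtype_coe) .of_discrete

theorem mem_rayCylinder_of_iff [DecidableEq α] (i : α) {X : ℕ → FreeGroup α} {r : Boundary α}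
    (h : ConvergesTo X r) :
    r ∈ rayCylinder (of i) ↔ ∀ᶠ k in atTop, X k ∈ shadow (of i) := by
  constructor
  · rintro ⟨k, hk⟩
    rw [← hk]
    exact h k
  · intro hev
    obtain ⟨k, h1, h2⟩ := ((h 1).and hev).exists
    exact ⟨1, eq_of_mem_shadow h1 h2 (by rw [norm_ray, norm_of])⟩

variable [Countable α]

theorem measurableSet_lastVisit (i : α) (y : FreeGroup α) : MeasurableSet (lastVisit i y) := by
  have : lastVisit i y = ⋃ K, (fun ω => walk 1 ω K) ⁻¹' {y} ∩
      ⋂ k : ℕ, ⋂ _ : k > K, (fun ω => walk 1 ω k) ⁻¹' (Set.range fun s : ℤ => of i ^ s)ᶜ := by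
    ext ω
    simp [lastVisit]
  rw [this]
  exact .iUnion fun K => (measurable_walk 1 K .of_discrete).inter
    (.iInter fun k => .iInter fun _ => measurable_walk 1 k .of_discrete)

/-- The last visit to the powers of `a i` is at `a i ^ s` if the walk reaches `a i ^ s` and then,
started afresh, has its last visit at the starting point. -/
theorem stepLaw_lastVisit (μ : PMF (FreeGroup α)) (i : α) (s : ℤ) :
    stepLaw μ (lastVisit i (of i ^ s)) =
      firstPassage μ 1 (of i ^ s) * stepLaw μ (lastVisit i 1) := by
  rw [lastVisit_of_zpow, stepLaw_iUnion_hitAt_inter_shift μ (measurableSet_lastVisit i 1)]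

end LastVisit

/-! ### Hitting probabilities of the powers of a generator -/

open FreeGroup

/-- Fekete's lemma for supermultiplicative sequences in `(0, 1]`. -/
theorem le_liminf_rpow_pow {q : ℕ → ℝ≥0∞} (hq0 : ∀ k, q k ≠ 0) (hq1 : ∀ k, q k ≤ 1)
    (hq : ∀ k l, q k * q l ≤ q (k + l)) {k : ℕ} (hk : k ≠ 0) :
    q k ≤ liminf (fun k : ℕ => q k ^ (1 / (k : ℝ))) atTop ^ k := by
  have hqt : ∀ k, q k ≠ ∞ := fun k => ne_top_of_le_ne_top ENNReal.one_ne_top (hq1 k)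
  have hpos : ∀ k, 0 < (q k).toReal := fun k => ENNReal.toReal_pos (hq0 k) (hqt k)
  let u : ℕ → ℝ := fun k => -Real.log (q k).toReal
  have hu0 : ∀ k, 0 ≤ u k := fun k =>
    neg_nonneg.2 (Real.log_nonpos (hpos k).le (ENNReal.toReal_mono ENNReal.one_ne_top (hq1 k)))
  have hsub : Subadditive u := by
    intro k l
    simp only [u]
    rw [← neg_add, neg_le_neg_iff, ← Real.log_mul (hpos k).ne' (hpos l).ne', ← ENNReal.toReal_mul]
    exact Real.log_le_log (ENNReal.toReal_pos (mul_ne_zero (hq0 k) (hq0 l))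
      (ENNReal.mul_ne_top (hqt k) (hqt l))) (ENNReal.toReal_mono (hqt _) (hq k l))
  have hbdd : BddBelow (Set.range fun k => u k / k) :=
    ⟨0, by rintro - ⟨k, rfl⟩; exact div_nonneg (hu0 k) k.cast_nonneg⟩
  have hexp : ∀ k, q k = ENNReal.ofReal (Real.exp (-u k)) := fun k => by
    simp only [u]
    rw [neg_neg, Real.exp_log (hpos k), ENNReal.ofReal_toReal (hqt k)]
  have hroot : ∀ k : ℕ, q k ^ (1 / (k : ℝ)) = ENNReal.ofReal (Real.exp (-(u k / k))) := fun k => by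
    rw [hexp, ENNReal.ofReal_rpow_of_pos (Real.exp_pos _), ← Real.exp_mul]
    congr 2
    ring
  have hlim : Tendsto (fun k : ℕ => q k ^ (1 / (k : ℝ))) atTop
      (nhds (ENNReal.ofReal (Real.exp (-hsub.lim)))) := by
    simp only [hroot]
    exact (ENNReal.continuous_ofReal.comp Real.continuous_exp).continuousAt.tendsto.comp
      (hsub.tendsto_lim hbdd).neg
  rw [hlim.liminf_eq, hexp, ← ENNReal.ofReal_pow (Real.exp_pos _).le, ← Real.exp_nat_mul]
  refine ENNReal.ofReal_le_ofReal (Real.exp_le_exp.2 ?_)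
  have h1 := hsub.lim_le_div hbdd hk
  rw [le_div_iff₀ (by exact_mod_cast Nat.pos_of_ne_zero hk)] at h1
  linarith

variable {α : Type*}

/-- The automorphism of the free group that inverts every generator. -/
def invertGenerators (α : Type*) : FreeGroup α ≃* FreeGroup α :=
  MonoidHom.toMulEquiv (lift fun i => (of i)⁻¹) (lift fun i => (of i)⁻¹)
    (FreeGroup.ext_hom _ _ fun i => by simp) (FreeGroup.ext_hom _ _ fun i => by simp)

theorem invertGenerators_of_zpow (i : α) (s : ℤ) :
    invertGenerators α (of i ^ s) = (of i ^ s)⁻¹ := by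
  rw [map_zpow, ← inv_zpow]
  congr 1

theorem invertGenerators_invertGenerators (g : FreeGroup α) :
    invertGenerators α (invertGenerators α g) = g :=
  (invertGenerators α).symm_apply_apply g

theorem apply_invertGenerators (μ : PMF (FreeGroup α)) (hsymm : ∀ g, μ g⁻¹ = μ g)
    (hsupp : ∀ g, μ g ≠ 0 → ∃ (i : α) (j : ℤ), j ≠ 0 ∧ g = of i ^ j) (g : FreeGroup α) :
    μ (invertGenerators α g) = μ g := by
  by_cases hg : μ g = 0
  · by_cases hg' : μ (invertGenerators α g) = 0
    · rw [hg, hg']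
    · obtain ⟨i, j, -, h⟩ := hsupp _ hg'
      have h1 : g = (invertGenerators α g)⁻¹ := by
        conv_lhs => rw [← invertGenerators_invertGenerators g, h, invertGenerators_of_zpow, ← h]
      rw [← hsymm, ← h1]
  · obtain ⟨i, j, -, rfl⟩ := hsupp g hg
    rw [invertGenerators_of_zpow, hsymm]

/-- With `F k = F(e, g ^ k)` and `ρ` the decay rate, supermultiplicativity gives `F k ≤ ρ ^ k`.
Hence, if `ρ < 1`, then `S = ∑ k ≥ 1, F k` is at most `ρ / (1 - ρ)`, which is the claim
`S ≤ ρ * (1 + S)`. -/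
theorem tsum_firstPassage_succ_le [Countable α] (μ : PMF (FreeGroup α)) {g : FreeGroup α}
    (hg : μ g ≠ 0) :
    ∑' k : ℕ, firstPassage μ 1 (g ^ (k + 1)) ≤
      decayRate μ g * ∑' k : ℕ, firstPassage μ 1 (g ^ k) := by
  have hle : ∀ k : ℕ, firstPassage μ 1 (g ^ (k + 1)) ≤ decayRate μ g ^ (k + 1) := fun k =>
    le_liminf_rpow_pow (q := fun k => firstPassage μ 1 (g ^ k)) (firstPassage_pow_ne_zero μ hg)
      (fun k => firstPassage_le_one μ _ _)
      (fun k l => by rw [pow_add]; exact firstPassage_mul_le μ _ _) k.succ_ne_zero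
  generalize decayRate μ g = ρ at hle ⊢
  have hsplit : ∑' k : ℕ, firstPassage μ 1 (g ^ k) =
      1 + ∑' k : ℕ, firstPassage μ 1 (g ^ (k + 1)) := by
    rw [tsum_eq_zero_add' ENNReal.summable, pow_zero, firstPassage_self]
  rw [hsplit]
  set S := ∑' k : ℕ, firstPassage μ 1 (g ^ (k + 1))
  rcases le_or_gt 1 ρ with hρ | hρ
  · calc S ≤ 1 + S := le_add_self
      _ ≤ ρ * (1 + S) := le_mul_of_one_le_left zero_le hρ
  · have hS : S ≤ ρ * (1 - ρ)⁻¹ := by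
      refine (ENNReal.tsum_le_tsum hle).trans ?_
      simp only [pow_succ']
      rw [ENNReal.tsum_mul_left, ENNReal.tsum_geometric]
    have hne : 1 - ρ ≠ 0 := (tsub_pos_of_lt hρ).ne'
    have hnt : 1 - ρ ≠ ∞ := ENNReal.sub_ne_top ENNReal.one_ne_top
    have h1 : (1 - ρ) * S ≤ ρ := by
      calc (1 - ρ) * S ≤ (1 - ρ) * (ρ * (1 - ρ)⁻¹) := by gcongr
        _ = ρ := by rw [mul_left_comm, ENNReal.mul_inv_cancel hne hnt, mul_one]
    calc S = (1 - ρ) * S + ρ * S := by rw [← add_mul, tsub_add_cancel_of_le hρ.le, one_mul]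
      _ ≤ ρ + ρ * S := by gcongr
      _ = ρ * (1 + S) := by rw [mul_add, mul_one]

/-- The limit of the walk lies in the cylinder of `a i` exactly when its last visit to the powers of
`a i` is at a positive power. -/
theorem ae_mem_rayCylinder_iff [DecidableEq α] (μ : PMF (FreeGroup α)) (i : α)
    (hsupp : ∀ g, μ g ≠ 0 → ∃ (i : α) (j : ℤ), j ≠ 0 ∧ g = of i ^ j)
    (hconv : ∀ᵐ ω ∂stepLaw μ, ∃ r : Boundary α, ConvergesTo (walk 1 ω) r)
    (hlast : ∀ᵐ ω ∂stepLaw μ, ∀ᶠ k in atTop,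
      walk 1 ω k ∉ Set.range fun s : ℤ => of i ^ s) :
    ∀ᵐ ω ∂stepLaw μ, ∃ s : ℤ, ω ∈ lastVisit i (of i ^ s) ∧
      ((∃ r ∈ rayCylinder (of i), ConvergesTo (walk 1 ω) r) ↔ 0 < s) := by
  filter_upwards [hconv, hlast, ae_forall_step_ne_zero μ] with ω ⟨r, hr⟩ h2 h3
  obtain ⟨s, hs⟩ := exists_mem_lastVisit i h2
  refine ⟨s, hs, ?_⟩
  rw [← eventually_mem_shadow_iff i (fun k => let ⟨b, j, _, h⟩ := hsupp _ (h3 k); ⟨b, j, h⟩) hs,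
    ← mem_rayCylinder_of_iff i hr]
  exact ⟨fun ⟨r', h', hr'⟩ => hr.unique hr' ▸ h', fun h => ⟨r, h, hr⟩⟩

/-- The hitting measure of the cylinder of `a i` and of its complement, as sums over the position of
the last visit to the powers of `a i`. -/
theorem hittingMeasure_rayCylinder [DecidableEq α] [Countable α] (μ : PMF (FreeGroup α)) (i : α)
    (hsymm : ∀ g, μ g⁻¹ = μ g)
    (hsupp : ∀ g, μ g ≠ 0 → ∃ (i : α) (j : ℤ), j ≠ 0 ∧ g = of i ^ j)
    (hconv : ∀ᵐ ω ∂stepLaw μ, ∃ r : Boundary α, ConvergesTo (walk 1 ω) r)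
    (hlast : ∀ᵐ ω ∂stepLaw μ, ∀ᶠ k in atTop,
      walk 1 ω k ∉ Set.range fun s : ℤ => of i ^ s) :
    hittingMeasure μ (rayCylinder (of i)) =
        (∑' k : ℕ, firstPassage μ 1 (of i ^ (k + 1))) * stepLaw μ (lastVisit i 1) ∧
      1 - hittingMeasure μ (rayCylinder (of i)) =
        (∑' k : ℕ, firstPassage μ 1 (of i ^ k)) * stepLaw μ (lastVisit i 1) := by
  have hae := ae_mem_rayCylinder_iff μ i hsupp hconv hlast
  let E : ℤ → Set (ℕ → FreeGroup α) := fun s => lastVisit i (of i ^ s)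
  have hE : ∀ s, MeasurableSet (E s) := fun s => measurableSet_lastVisit i _
  have hdisj : Pairwise (Function.onFun Disjoint E) := disjoint_lastVisit i
  have huniq : ∀ {ω s s'}, ω ∈ E s → ω ∈ E s' → s = s' := by
    intro ω s s' h h'
    by_contra hne
    exact Set.disjoint_left.1 (hdisj hne) h h'
  have hpos : hittingMeasure μ (rayCylinder (of i)) = stepLaw μ (⋃ k : ℕ, E (k + 1)) := by
    rw [hittingMeasure_apply μ (measurableSet_rayCylinder _)]
    refine measure_congr (eventuallyEq_set.2 ?_)
    filter_upwards [hae] with ω ⟨s, hs, hiff⟩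
    refine hiff.trans ?_
    rw [Set.mem_iUnion]
    constructor
    · intro h
      refine ⟨(s - 1).toNat, ?_⟩
      rwa [Int.toNat_of_nonneg (by omega), sub_add_cancel]
    · rintro ⟨k, hk⟩
      have := huniq hs hk
      omega
  have hneg : 1 - hittingMeasure μ (rayCylinder (of i)) =
      stepLaw μ (⋃ k : ℕ, E (-(k : ℤ))) := by
    rw [hpos, ← prob_compl_eq_one_sub (.iUnion fun k => hE _)]
    refine measure_congr (eventuallyEq_set.2 ?_)
    filter_upwards [hae] with ω ⟨s, hs, _⟩
    rw [Set.mem_compl_iff, Set.mem_iUnion, Set.mem_iUnion]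
    constructor
    · intro h
      have hs0 : s ≤ 0 := by
        by_contra hcon
        refine h ⟨(s - 1).toNat, ?_⟩
        rwa [Int.toNat_of_nonneg (by omega), sub_add_cancel]
      refine ⟨(-s).toNat, ?_⟩
      rwa [Int.toNat_of_nonneg (by omega), neg_neg]
    · rintro ⟨k, hk⟩ ⟨l, hl⟩
      have := huniq hk hl
      omega
  constructor
  · have hdisj' : Pairwise (Function.onFun Disjoint fun k : ℕ => E (k + 1)) :=
      hdisj.comp_of_injective (f := fun k : ℕ => (k : ℤ) + 1) fun k l hkl => by simpa using hkl
    rw [hpos, measure_iUnion hdisj' fun k => hE _,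
      ← ENNReal.tsum_mul_right]
    refine tsum_congr fun k => ?_
    exact_mod_cast stepLaw_lastVisit μ i (k + 1)
  · have hdisj' : Pairwise (Function.onFun Disjoint fun k : ℕ => E (-(k : ℤ))) :=
      hdisj.comp_of_injective (f := fun k : ℕ => -(k : ℤ)) fun k l hkl => by simpa using hkl
    rw [hneg, measure_iUnion hdisj' fun k => hE _,
      ← ENNReal.tsum_mul_right]
    refine tsum_congr fun k => ?_
    -- Inverting all generators exchanges `a i ^ k` and `a i ^ (-k)`.
    change stepLaw μ (lastVisit i (of i ^ (-(k : ℤ)))) = _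
    rw [stepLaw_lastVisit, ← firstPassage_map μ (invertGenerators α)
      (apply_invertGenerators μ hsymm hsupp), _root_.map_one, invertGenerators_of_zpow, zpow_neg,
      inv_inv, zpow_natCast]

end FreeGroupWalk

theorem theorem1p1 (m n : ℕ) (hm : 2 ≤ m) (hn : 1 ≤ n)
    (μ : PMF (FreeGroup (Fin m)))
    (hsymm : ∀ g, μ g⁻¹ = μ g)
    (hsupp : μ.support =
      {g | ∃ (i : Fin m) (j : ℤ), 1 ≤ |j| ∧ |j| ≤ n ∧ g = FreeGroup.of i ^ j}) :
    (∀ᵐ ω ∂stepLaw μ, ∃ r : Boundary (Fin m), ConvergesTo (walk 1 ω) r) ∧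
    ∀ i : Fin m,
      hittingMeasure μ (rayCylinder (FreeGroup.of i)) /
          (1 - hittingMeasure μ (rayCylinder (FreeGroup.of i))) ≤
        decayRate μ (FreeGroup.of i) := by
  have hsupp1 : ∀ g, μ g ≠ 0 →
      ∃ (i : Fin m) (j : ℤ), j ≠ 0 ∧ j.natAbs ≤ n ∧ g = FreeGroup.of i ^ j := by
    intro g hg
    have hmem : g ∈ μ.support := (μ.mem_support_iff g).2 hg
    rw [hsupp] at hmem
    obtain ⟨i, j, h1, h2, rfl⟩ := hmem
    refine ⟨i, j, ?_, ?_, rfl⟩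
    · rintro rfl
      simp at h1
    · rw [Int.abs_eq_natAbs] at h2
      exact_mod_cast h2
  have hsupp2 : ∀ g, μ g ≠ 0 → ∃ (i : Fin m) (j : ℤ), j ≠ 0 ∧ g = FreeGroup.of i ^ j :=
    fun g hg => let ⟨i, j, hj, _, h⟩ := hsupp1 g hg; ⟨i, j, hj, h⟩
  have hpos : ∀ i : Fin m, μ (FreeGroup.of i) ≠ 0 := by
    intro i
    rw [← μ.mem_support_iff, hsupp]
    exact ⟨i, 1, by simp, by simpa using hn, by simp⟩
  have hcard : 2 ≤ Fintype.card (Fin m) := by rwa [Fintype.card_fin]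
  have hconv := ae_exists_convergesTo hcard μ hsymm hsupp1 hpos
  refine ⟨hconv, fun i => ENNReal.div_le_of_le_mul ?_⟩
  obtain ⟨h1, h2⟩ := hittingMeasure_rayCylinder μ i hsymm hsupp2 hconv
    (ae_eventually_notMem_powers hcard μ hsymm hsupp2 hpos i)
  rw [h2, h1, ← mul_assoc]
  gcongr
  exact tsum_firstPassage_succ_le μ (hpos i)
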